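/- Let $M$ be a connected smooth (Hausdorff) manifold of dimension $n$, and let $\nabla$ be a smooth linear connection on $M$, i.e. a covariant derivative on $TM$, not necessarily torsion-free. A semi-Riemannian metric on $M$ is a smooth field of nondegenerate symmetric bilinear forms on the tangent spaces, of any signature; it is parallel if $\nabla g=0$, i.e. $X(g(Y,Z))=g(\nabla_XY,Z)+g(Y,\nabla_XZ)$ for all vector fields $X,Y,Z$. Metrics $g_1,\dots,g_k$ are called independent if they are linearly independent over $\mathbb{R}$ as tensor fields on $M$. For $x\in M$ the holonomy group $\Psi(x)$ is the group of linear automorphisms of $T_xM$ given by parallel translation along piecewise $C^1$ loops at $x$. The connection has reducible holonomy if, for some (equivalently, every) $x\in M$, there is a linear subspace $W$ with $0\neq W\neq T_xM$ and $\psi(W)\subseteq W$ for all $\psi\in\Psi(x)$. Then $\nabla$ has reducible holonomy in each of the following cases: (i) there are two independent semi-Riemannian metrics $g_1,g_2$ on $M$, parallel with respect to $\nabla$, one of which has signature $(p,q)$ with $p\neq q$; (ii) $n=2$ and there are two independent semi-Riemannian metrics on $M$, parallel with respect to $\nabla$; (iii) $n\not\equiv 0 \pmod 4$ and there are three independent semi-Riemannian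 metrics on $M$, parallel with respect to $\nabla$; (iv) there are four independent semi-Riemannian metrics on $M$, parallel with respect to $\nabla$. -/

import Mathlib

open Set Bundle
open scoped Manifold ContDiff

noncomputable section

/-- A semi-Riemannian metric on an `n`-dimensional smooth manifold `M`: a smooth field of
symmetric nondegenerate bilinear forms on the tangent spaces. (Of any signature, definite or not.
On a connected manifold the signature is automatically constant.) -/
structure SemiRiemannianMetric (n : ℕ) (M : Type*) [TopologicalSpace M]
    [ChartedSpace (EuclideanSpace ℝ (Fin n)) M] [IsManifold (𝓡 n) ∞ M] where
  /-- The bilinear form on the tangent space at `x`. -/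
  toFun (x : M) : TangentSpace (𝓡 n) x →L[ℝ] TangentSpace (𝓡 n) x →L[ℝ] ℝ
  symm (x : M) (v w : TangentSpace (𝓡 n) x) : toFun x v w = toFun x w v
  nondegenerate (x : M) (v : TangentSpace (𝓡 n) x) (hv : ∀ w, toFun x v w = 0) : v = 0
  smooth : ContMDiff (𝓡 n)
    ((𝓡 n).prod 𝓘(ℝ, EuclideanSpace ℝ (Fin n) →L[ℝ] EuclideanSpace ℝ (Fin n) →L[ℝ] ℝ)) ∞
    (fun x ↦ TotalSpace.mk' (EuclideanSpace ℝ (Fin n) →L[ℝ] EuclideanSpace ℝ (Fin n) →L[ℝ] ℝ)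
      (E := fun x : M ↦ TangentSpace (𝓡 n) x →L[ℝ] TangentSpace (𝓡 n) x →L[ℝ] ℝ) x (toFun x))

/-- A (smooth) linear connection on `M`, that is, a smooth covariant derivative on the tangent
bundle; it may have torsion. In Mathlib's argument order, `cov Y x (X x)` is `(∇_X Y)(x)`. -/
structure LinearConnection (n : ℕ) (M : Type*) [TopologicalSpace M]
    [ChartedSpace (EuclideanSpace ℝ (Fin n)) M] [IsManifold (𝓡 n) ∞ M] where
  /-- The underlying covariant derivative. -/
  cov : CovariantDerivative (𝓡 n) (EuclideanSpace ℝ (Fin n))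
    (fun x : M ↦ TangentSpace (𝓡 n) x)
  smooth : cov.ContMDiffCovariantDerivative ∞

section

variable {n : ℕ} {M : Type*} [TopologicalSpace M]
  [ChartedSpace (EuclideanSpace ℝ (Fin n)) M] [IsManifold (𝓡 n) ∞ M]

namespace SemiRiemannianMetric

/-- The quadratic form `v ↦ g(v, v)` on the tangent space at `x`. -/
def quadraticForm (g : SemiRiemannianMetric n M) (x : M) :
    QuadraticForm ℝ (TangentSpace (𝓡 n) x) :=
  LinearMap.BilinMap.toQuadraticMap (g.toFun x).toLinearMap₁₂

/-- The metric has signature `(p, q)`: at each point, `p` is the maximal dimension of a positive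
definite subspace and `q` the maximal dimension of a negative definite subspace. -/
def HasSignature (g : SemiRiemannianMetric n M) (p q : ℕ) : Prop :=
  ∀ x : M, sigPos (g.quadraticForm x) = p ∧ sigNeg (g.quadraticForm x) = q

/-- The metric `g` is parallel, `∇ g = 0`: for every point `x`, every tangent vector `X` at `x` and
all vector fields `Y`, `Z` that are differentiable at `x`,
`X (g(Y, Z)) = g(∇_X Y, Z) + g(Y, ∇_X Z)`. -/
def IsParallel (g : SemiRiemannianMetric n M) (D : LinearConnection n M) : Prop :=
  ∀ (x : M) (X : TangentSpace (𝓡 n) x) (Y Z : ∀ y : M, TangentSpace (𝓡 n) y),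
    MDifferentiableAt (𝓡 n) (𝓡 n).tangent (fun y ↦ (⟨y, Y y⟩ : TangentBundle (𝓡 n) M)) x →
    MDifferentiableAt (𝓡 n) (𝓡 n).tangent (fun y ↦ (⟨y, Z y⟩ : TangentBundle (𝓡 n) M)) x →
      mvfderiv (𝓡 n) (fun y ↦ g.toFun y (Y y) (Z y)) x X
        = g.toFun x (D.cov Y x X) (Z x) + g.toFun x (Y x) (D.cov Z x X)

end SemiRiemannianMetric

namespace LinearConnection

/-- Within `s`, the vector field `V` along the curve `γ` has covariant derivative `A` at time `t`.
Let `e` be the trivialization of the tangent bundle at `γ t`, with frame `E₁, …, Eₙ`, and write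
`V = ∑ vⁱ Eᵢ(γ)`. Then `DV/dt = ∑ (vⁱ)' Eᵢ + ∑ vⁱ ∇_{γ'} Eᵢ`, and at time `t` the second sum is
`∇_{γ'}` of the vector field `FiberBundle.extend _ (V t)`, which has constant coefficients
`vⁱ(t)` in the frame. -/
def HasCovDerivAlongWithinAt (D : LinearConnection n M) (γ : ℝ → M)
    (V : ∀ t : ℝ, TangentSpace (𝓡 n) (γ t)) (s : Set ℝ) (t : ℝ)
    (A : TangentSpace (𝓡 n) (γ t)) : Prop :=
  let e := trivializationAt (EuclideanSpace ℝ (Fin n)) (TangentSpace (𝓡 n) : M → Type _) (γ t)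
  let velocity : TangentSpace (𝓡 n) (γ t) := mfderivWithin 𝓘(ℝ) (𝓡 n) γ s t (1 : ℝ)
  HasDerivWithinAt (fun u ↦ (e ⟨γ u, V u⟩).2)
    (e ⟨γ t, A - D.cov (FiberBundle.extend (EuclideanSpace ℝ (Fin n)) (V t)) (γ t) velocity⟩).2 s t

/-- The linear isomorphism `τ : T_x M → T_y M` is parallel translation along the `C¹` curve
`γ : [0, 1] → M` from `x` to `y`: for each `v`, there is a vector field along `γ` with vanishing
covariant derivative, starting at `v` and ending at `τ v`. -/
def IsParallelTranslationAlong (D : LinearConnection n M) (γ : ℝ → M) (x y : M)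
    (τ : TangentSpace (𝓡 n) x ≃ₗ[ℝ] TangentSpace (𝓡 n) y) : Prop :=
  ContMDiffOn 𝓘(ℝ) (𝓡 n) 1 γ (Icc 0 1) ∧ γ 0 = x ∧ γ 1 = y ∧
    ∀ v : TangentSpace (𝓡 n) x, ∃ V : ∀ t : ℝ, TangentSpace (𝓡 n) (γ t),
      (∀ t ∈ Icc (0 : ℝ) 1, D.HasCovDerivAlongWithinAt γ V (Icc 0 1) t 0) ∧
      (⟨γ 0, V 0⟩ : TangentBundle (𝓡 n) M) = ⟨x, v⟩ ∧
      (⟨γ 1, V 1⟩ : TangentBundle (𝓡 n) M) = ⟨y, τ v⟩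

/-- `D.IsParallelTranslation x y τ` says that `τ : T_x M → T_y M` is parallel translation along
some piecewise `C¹` curve from `x` to `y`, that is, along a concatenation of finitely many `C¹`
curves. -/
inductive IsParallelTranslation (D : LinearConnection n M) :
    (x y : M) → (TangentSpace (𝓡 n) x ≃ₗ[ℝ] TangentSpace (𝓡 n) y) → Prop
  | of_curve {x y : M} {τ : TangentSpace (𝓡 n) x ≃ₗ[ℝ] TangentSpace (𝓡 n) y} (γ : ℝ → M)
      (h : D.IsParallelTranslationAlong γ x y τ) : IsParallelTranslation D x y τ
  | concat {x y z : M} {τ : TangentSpace (𝓡 n) x ≃ₗ[ℝ] TangentSpace (𝓡 n) y}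
      {τ' : TangentSpace (𝓡 n) y ≃ₗ[ℝ] TangentSpace (𝓡 n) z}
      (h : IsParallelTranslation D x y τ) (h' : IsParallelTranslation D y z τ') :
      IsParallelTranslation D x z (τ.trans τ')

theorem isParallelTranslation_refl (D : LinearConnection n M) (x : M) :
    D.IsParallelTranslation x x (LinearEquiv.refl ℝ _) := by
  refine .of_curve (fun _ ↦ x) ⟨contMDiffOn_const, rfl, rfl, fun v ↦ ⟨fun _ ↦ v, ?_, rfl, rfl⟩⟩
  intro t ht
  have h0 : mfderivWithin 𝓘(ℝ) (𝓡 n) (fun _ : ℝ ↦ x) (Icc 0 1) t = 0 := by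
    simp [mfderivWithin_const]
  unfold HasCovDerivAlongWithinAt
  simp only [h0]
  have h1 : (0 : TangentSpace (𝓡 n) x) -
      D.cov (FiberBundle.extend (EuclideanSpace ℝ (Fin n)) v) x
        ((0 : TangentSpace 𝓘(ℝ) t →L[ℝ] TangentSpace (𝓡 n) x) (1 : ℝ)) = 0 := by
    rw [zero_sub, neg_eq_zero]
    exact map_zero _
  erw [h1]
  have h2 : (trivializationAt (EuclideanSpace ℝ (Fin n)) (TangentSpace (𝓡 n) : M → Type _) x
      ⟨x, 0⟩).2 = 0 := by
    have hx : x ∈ (trivializationAt (EuclideanSpace ℝ (Fin n))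
      (TangentSpace (𝓡 n) : M → Type _) x).baseSet := FiberBundle.mem_baseSet_trivializationAt' x
    have := (trivializationAt (EuclideanSpace ℝ (Fin n))
      (TangentSpace (𝓡 n) : M → Type _) x).zeroSection ℝ hx
    exact congrArg Prod.snd this
  rw [h2]
  exact hasDerivWithinAt_const _ _ _

theorem HasCovDerivAlongWithinAt.reverse {D : LinearConnection n M} {γ : ℝ → M}
    {V : ∀ t : ℝ, TangentSpace (𝓡 n) (γ t)}
    (hγ : ContMDiffOn 𝓘(ℝ) (𝓡 n) 1 γ (Icc 0 1)) {t : ℝ} (ht : t ∈ Icc (0 : ℝ) 1)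
    (h : D.HasCovDerivAlongWithinAt γ V (Icc 0 1) (1 - t) 0) :
    D.HasCovDerivAlongWithinAt (fun u ↦ γ (1 - u)) (fun u ↦ V (1 - u)) (Icc 0 1) t 0 := by
  have ht' : 1 - t ∈ Icc (0 : ℝ) 1 := ⟨by linarith [ht.2], by linarith [ht.1]⟩
  have hmaps : MapsTo (fun u : ℝ ↦ 1 - u) (Icc 0 1) (Icc 0 1) :=
    fun u hu ↦ ⟨by linarith [hu.2], by linarith [hu.1]⟩
  have hd : HasDerivWithinAt (fun u : ℝ ↦ 1 - u) (-1) (Icc 0 1) t := by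
    simpa using (hasDerivWithinAt_id t (Icc (0 : ℝ) 1)).const_sub 1
  have hvel : mfderivWithin 𝓘(ℝ) (𝓡 n) (fun u ↦ γ (1 - u)) (Icc 0 1) t (1 : ℝ) =
      -(mfderivWithin 𝓘(ℝ) (𝓡 n) γ (Icc 0 1) (1 - t) (1 : ℝ)) := by
    have h1 : MDifferentiableWithinAt 𝓘(ℝ) (𝓡 n) γ (Icc 0 1) (1 - t) :=
      (hγ.mdifferentiableOn one_ne_zero) _ ht'
    have h2 : HasMFDerivWithinAt 𝓘(ℝ) 𝓘(ℝ) (fun u : ℝ ↦ 1 - u) (Icc 0 1) t _ :=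
      hd.hasFDerivWithinAt.hasMFDerivWithinAt
    have h3 := (h1.hasMFDerivWithinAt.comp t h2 hmaps).mfderivWithin
      (uniqueMDiffWithinAt_iff_uniqueDiffWithinAt.2 (uniqueDiffOn_Icc_zero_one t ht))
    have h4 := congrArg (fun L ↦ L (1 : ℝ)) h3
    refine h4.trans ?_
    have h6 := (mfderivWithin 𝓘(ℝ) (𝓡 n) γ (Icc 0 1) (1 - t)).map_neg (1 : ℝ)
    rw [← h6]
    refine congrArg (mfderivWithin 𝓘(ℝ) (𝓡 n) γ (Icc 0 1) (1 - t)) ?_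
    exact one_smul ℝ (-1 : ℝ)
  have h1 := HasDerivWithinAt.scomp t h hd hmaps
  unfold HasCovDerivAlongWithinAt
  refine h1.congr_deriv ?_
  have hx := FiberBundle.mem_baseSet_trivializationAt' (F := EuclideanSpace ℝ (Fin n))
    (E := (TangentSpace (𝓡 n) : M → Type _)) (γ (1 - t))
  have hlin := (trivializationAt (EuclideanSpace ℝ (Fin n))
    (TangentSpace (𝓡 n) : M → Type _) (γ (1 - t))).linear ℝ hx
  refine (hlin.map_smul (-1 : ℝ) _).symm.trans ?_
  refine congrArg (fun w : TangentSpace (𝓡 n) (γ (1 - t)) ↦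
    ((trivializationAt (EuclideanSpace ℝ (Fin n)) (TangentSpace (𝓡 n) : M → Type _) (γ (1 - t)))
      ⟨γ (1 - t), w⟩).2) ?_
  have h2 := (D.cov (FiberBundle.extend (EuclideanSpace ℝ (Fin n)) (V (1 - t)))
    (γ (1 - t))).map_neg (mfderivWithin 𝓘(ℝ) (𝓡 n) γ (Icc 0 1) (1 - t) (1 : ℝ))
  rw [zero_sub, zero_sub, neg_smul, one_smul, neg_neg]
  refine Eq.trans ?_ (congrArg Neg.neg ((congrArg (D.cov (FiberBundle.extend
    (EuclideanSpace ℝ (Fin n)) (V (1 - t))) (γ (1 - t))) hvel).trans h2)).symm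
  exact (neg_neg _).symm

theorem IsParallelTranslationAlong.reverse {D : LinearConnection n M} {γ : ℝ → M} {x y : M}
    {τ : TangentSpace (𝓡 n) x ≃ₗ[ℝ] TangentSpace (𝓡 n) y}
    (h : D.IsParallelTranslationAlong γ x y τ) :
    D.IsParallelTranslationAlong (fun u ↦ γ (1 - u)) y x τ.symm := by
  obtain ⟨hγ, h0, h1, hV⟩ := h
  refine ⟨?_, by simpa using h1, by simpa using h0, fun w ↦ ?_⟩
  · refine hγ.comp (ContDiffOn.contMDiffOn (by fun_prop)) ?_
    exact fun u hu ↦ ⟨by linarith [hu.2], by linarith [hu.1]⟩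
  · obtain ⟨V, hpar, hV0, hV1⟩ := hV (τ.symm w)
    refine ⟨fun u ↦ V (1 - u), fun t ht ↦ ?_, ?_, ?_⟩
    · exact (hpar (1 - t) ⟨by linarith [ht.2], by linarith [ht.1]⟩).reverse hγ ht
    · have e : (1 : ℝ) - 0 = 1 := by norm_num
      rw [τ.apply_symm_apply] at hV1
      refine Eq.trans ?_ hV1
      exact congrArg (fun r : ℝ ↦ (⟨γ r, V r⟩ : TangentBundle (𝓡 n) M)) e
    · have e : (1 : ℝ) - 1 = 0 := by norm_num
      refine Eq.trans ?_ hV0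
      exact congrArg (fun r : ℝ ↦ (⟨γ r, V r⟩ : TangentBundle (𝓡 n) M)) e

theorem IsParallelTranslation.symm {D : LinearConnection n M} {x y : M}
    {τ : TangentSpace (𝓡 n) x ≃ₗ[ℝ] TangentSpace (𝓡 n) y} (h : D.IsParallelTranslation x y τ) :
    D.IsParallelTranslation y x τ.symm := by
  induction h with
  | of_curve γ h => exact .of_curve _ h.reverse
  | concat h h' ih ih' => exact .concat ih' ih

/-- The holonomy group `Ψ(x)` of the connection at `x`: the parallel translations along piecewise
`C¹` loops at `x`. -/
def holonomyGroup (D : LinearConnection n M) (x : M) :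
    Subgroup (TangentSpace (𝓡 n) x ≃ₗ[ℝ] TangentSpace (𝓡 n) x) where
  carrier := {ψ | D.IsParallelTranslation x x ψ}
  mul_mem' ha hb := IsParallelTranslation.concat hb ha
  one_mem' := D.isParallelTranslation_refl x
  inv_mem' h := IsParallelTranslation.symm h

end LinearConnection

end

/-- The group `G` of linear automorphisms of `V` acts reducibly: some proper nontrivial subspace is
invariant. -/
def ActsReducibly {V : Type*} [AddCommGroup V] [Module ℝ V] (G : Subgroup (V ≃ₗ[ℝ] V)) : Prop :=
  ∃ W : Submodule ℝ V, W ≠ ⊥ ∧ W ≠ ⊤ ∧ ∀ ψ ∈ G, ∀ v ∈ W, ψ v ∈ W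

/-- The connection has reducible holonomy: its holonomy groups act reducibly. (On a connected
manifold, this holds at one point if and only if it holds at all points.) -/
def LinearConnection.HasReducibleHolonomy {n : ℕ} {M : Type*} [TopologicalSpace M]
    [ChartedSpace (EuclideanSpace ℝ (Fin n)) M] [IsManifold (𝓡 n) ∞ M]
    (D : LinearConnection n M) : Prop :=
  ∀ x : M, ActsReducibly (D.holonomyGroup x)

/-- `g₁, …, g_k` are `k` independent metrics, all parallel with respect to the connection:
independent means linearly independent over `ℝ` as tensor fields on `M`. -/
def LinearConnection.AreIndependentParallelMetrics {n : ℕ} {M : Type*} [TopologicalSpace M]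
    [ChartedSpace (EuclideanSpace ℝ (Fin n)) M] [IsManifold (𝓡 n) ∞ M]
    (D : LinearConnection n M) {k : ℕ} (g : Fin k → SemiRiemannianMetric n M) : Prop :=
  (∀ c : Fin k → ℝ, (∀ (x : M) (v w : TangentSpace (𝓡 n) x), ∑ i, c i * (g i).toFun x v w = 0) →
    ∀ i, c i = 0) ∧ ∀ i, (g i).IsParallel D

end

/-! Parallel translation preserves every parallel metric, so at a point `x` all the given metrics
are invariant under the holonomy group. A linear combination of them satisfies a linear ODE along
curves, hence vanishes everywhere on the connected manifold once it vanishes at `x`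
(`sum_parallel_metrics_eq_zero`). Independence on `M` therefore gives independence on the single
space `T_x M`, and the rest is linear algebra.

Dividing the forms by one of them, `b`, yields independent `b`-self-adjoint endomorphisms commuting
with the holonomy group. If the group is irreducible, Schur's lemma makes its commutant a
finite-dimensional real domain; let `S` be the subspace of its self-adjoint elements, which contains
`1` and has dimension at least the number of metrics.

If `dim S ≥ 2`, a non-scalar element of `S`, shifted and scaled, is a complex structure `J`. As `b
(J v) (J v) = -b v v`, the signature is neutral, which is (i). In dimension two a holonomy map is
multiplication by a complex number of square `1`, so it is `±1` and preserves every line, which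
contradicts irreducibility and gives (ii).

If `dim S ≥ 3`, some `A` in `S` fails to commute with `J`; a multiple `K` of `A + J A J` is a second
complex structure, anticommuting with `J`. Then `T_x M` is a quaternionic space and `4 ∣ n`, which
is (iii).

Finally `S` is spanned by `1, J, K`: an element of the commutant is a combination of `1, J, K, J K`,
and `J K` is skew-adjoint because its adjoint is `K J = -J K`. Hence `dim S ≤ 3`, which is (iv). -/

open scoped Topology

/-! ### Schur's lemma for the commutant -/

section Algebra

variable {V : Type*} [AddCommGroup V] [Module ℝ V]

/-- The algebra of endomorphisms that commute with every element of `G`. -/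
def commutant (G : Subgroup (V ≃ₗ[ℝ] V)) : Subalgebra ℝ (Module.End ℝ V) :=
  Subalgebra.centralizer ℝ ((fun ψ : V ≃ₗ[ℝ] V ↦ (ψ : Module.End ℝ V)) '' G)

theorem mem_commutant {G : Subgroup (V ≃ₗ[ℝ] V)} {A : Module.End ℝ V} :
    A ∈ commutant G ↔ ∀ ψ ∈ G, ∀ v, A (ψ v) = ψ (A v) := by
  simp only [commutant, Subalgebra.mem_centralizer_iff, mem_image, SetLike.mem_coe,
    forall_exists_index, and_imp]
  exact ⟨fun h ψ hψ v ↦ (LinearMap.congr_fun (h _ ψ hψ rfl) v).symm,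
    fun h _ ψ hψ hψ' ↦ hψ' ▸ LinearMap.ext fun v ↦ (h ψ hψ v).symm⟩

/-- **Schur's lemma**: a nonzero endomorphism commuting with an irreducible group is injective. -/
theorem ker_eq_bot_of_mem_commutant {G : Subgroup (V ≃ₗ[ℝ] V)} (hG : ¬ ActsReducibly G)
    {A : Module.End ℝ V} (hA : A ∈ commutant G) (h0 : A ≠ 0) : LinearMap.ker A = ⊥ := by
  by_contra h
  refine hG ⟨LinearMap.ker A, h, fun ht ↦ h0 (LinearMap.ker_eq_top.1 ht), fun ψ hψ v hv ↦ ?_⟩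
  rw [LinearMap.mem_ker] at hv ⊢
  rw [mem_commutant.1 hA ψ hψ, hv, map_zero]

theorem noZeroDivisors_commutant {G : Subgroup (V ≃ₗ[ℝ] V)} (hG : ¬ ActsReducibly G) :
    NoZeroDivisors (commutant G) where
  eq_zero_or_eq_zero_of_mul_eq_zero {A B} h := by
    by_contra! hAB
    have hker := ker_eq_bot_of_mem_commutant hG A.2 (fun h ↦ hAB.1 (Subtype.ext h))
    refine hAB.2 (Subtype.ext (LinearMap.ext fun v ↦ ?_))
    refine LinearMap.ker_eq_bot.1 hker ?_
    rw [ZeroMemClass.coe_zero, LinearMap.zero_apply, map_zero]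
    exact LinearMap.congr_fun (congrArg Subtype.val h) v

end Algebra

/-! ### Complex structures in finite-dimensional real domains -/

section Domain

variable {R : Type*} [Ring R] [Algebra ℝ R] [NoZeroDivisors R] [Nontrivial R]

/-- In a finite-dimensional real domain, an element that is not a real scalar generates a copy of
the complex numbers. -/
theorem exists_smul_add_smul_one_mul_self_eq_neg_one [FiniteDimensional ℝ R] {A : R}
    (hA : ∀ c : ℝ, A ≠ c • 1) :
    ∃ a b : ℝ, a ≠ 0 ∧ (a • A + b • 1) * (a • A + b • 1) = (-1 : R) := by
  have : IsDomain R := NoZeroDivisors.to_isDomain R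
  have hint : IsIntegral ℝ A := Algebra.IsIntegral.isIntegral A
  have hdeg := (minpoly.irreducible hint).degree_le_two
  have hmonic := minpoly.monic hint
  obtain ⟨p, q, h⟩ : ∃ p q : ℝ, A * A + p • A + q • 1 = 0 := by
    have h0 := minpoly.aeval ℝ A
    rw [Polynomial.eq_quadratic_of_degree_le_two hdeg] at h0
    set c2 := (minpoly ℝ A).coeff 2
    set c1 := (minpoly ℝ A).coeff 1
    set c0 := (minpoly ℝ A).coeff 0
    simp only [map_add, map_mul, Polynomial.aeval_C, Polynomial.aeval_X, map_pow,
      Algebra.algebraMap_eq_smul_one, smul_mul_assoc, one_mul] at h0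
    -- A minimal polynomial of degree at most one would make `A` a scalar; otherwise dividing by the
    -- leading coefficient gives the quadratic relation.
    by_cases hc : c2 = 0
    · exfalso
      rw [hc, zero_smul, zero_add] at h0
      by_cases hc1 : c1 = 0
      · rw [hc1, zero_smul, zero_add] at h0
        have hc0 : c0 = 0 := (smul_eq_zero.1 h0).resolve_right one_ne_zero
        refine hmonic.ne_zero ?_
        rw [Polynomial.eq_quadratic_of_degree_le_two hdeg]
        change Polynomial.C c2 * _ + Polynomial.C c1 * _ + Polynomial.C c0 = 0
        simp [hc, hc1, hc0]
      · refine hA (-c0 / c1) ?_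
        have : A = c1⁻¹ • (c1 • A) := by rw [smul_smul, inv_mul_cancel₀ hc1, one_smul]
        rw [this, eq_neg_of_add_eq_zero_left h0, smul_neg, smul_smul, ← neg_smul]
        congr 1
        field_simp
    · refine ⟨c1 / c2, c0 / c2, ?_⟩
      have : c2⁻¹ • (c2 • A ^ 2 + c1 • A + c0 • (1 : R)) = 0 := by rw [h0, smul_zero]
      rw [← this, smul_add, smul_add, smul_smul, smul_smul, smul_smul, inv_mul_cancel₀ hc,
        one_smul, sq, div_eq_inv_mul, div_eq_inv_mul]
  -- Completing the square: `A + p/2` has the real square `d`. If `d ≥ 0`, the absence of zero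
  -- divisors forces `A + p/2 = ±√d`, a scalar; so `d < 0` and division by `√(-d)` normalises the
  -- square to `-1`.
  set d := p ^ 2 / 4 - q with hd
  have hB : (A + (p / 2) • 1) * (A + (p / 2) • 1) = d • (1 : R) := by
    have hAA : A * A = -(p • A) - q • 1 := by
      rw [eq_sub_iff_add_eq, eq_neg_iff_add_eq_zero, ← h]; abel
    simp only [mul_add, add_mul, smul_mul_assoc, mul_smul_comm, one_mul, mul_one, hAA]
    rw [hd]
    module
  rcases le_or_gt 0 d with hd0 | hd0
  · exfalso
    have h2 : (√d • (1 : R)) * (√d • 1) = d • 1 := by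
      rw [smul_mul_smul_comm, Real.mul_self_sqrt hd0, one_mul]
    rcases (Commute.mul_self_eq_mul_self_iff (by simp [commute_iff_eq])).1 (hB.trans h2.symm) with h3 | h3
    · refine hA (√d - p / 2) ?_
      rw [sub_smul, ← h3]; abel
    · refine hA (-√d - p / 2) ?_
      rw [sub_smul, neg_smul, ← h3]; abel
  · refine ⟨(√(-d))⁻¹, (√(-d))⁻¹ * (p / 2),
      inv_ne_zero (Real.sqrt_ne_zero'.2 (by linarith)), ?_⟩
    have hs : (√(-d)) * (√(-d)) = -d := Real.mul_self_sqrt (by linarith)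
    rw [mul_smul, ← smul_add, smul_mul_smul_comm, hB, smul_smul, ← mul_inv, hs, inv_neg,
      neg_mul, inv_mul_cancel₀ hd0.ne, neg_smul, one_smul]

/-- A normalisation of `A` to a complex structure `K` still commutes with `J`, so `(K - J) (K + J) =
K² - J² = 0` and `K = ±J`. -/
theorem eq_smul_one_add_smul_of_commute [FiniteDimensional ℝ R] {J A : R} (hJ : J * J = -1)
    (h : A * J = J * A) : ∃ a b : ℝ, A = a • 1 + b • J := by
  by_cases hA : ∃ c : ℝ, A = c • 1
  · obtain ⟨c, hc⟩ := hA
    exact ⟨c, 0, by rw [zero_smul, add_zero, hc]⟩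
  push Not at hA
  obtain ⟨a, b, ha, hK⟩ := exists_smul_add_smul_one_mul_self_eq_neg_one hA
  have key : ∀ s : ℝ, a • A + b • 1 = s • J → A = (-(a⁻¹ * b)) • 1 + (a⁻¹ * s) • J := by
    intro s hs
    rw [mul_smul, ← hs, smul_add, smul_smul, smul_smul, inv_mul_cancel₀ ha, one_smul, neg_smul]
    abel
  rcases (Commute.mul_self_eq_mul_self_iff
    (by simp [add_mul, mul_add, h] : (a • A + b • 1) * J = J * (a • A + b • 1))).1
    (hK.trans hJ.symm) with h1 | h1
  · exact ⟨_, _, key 1 (by rw [h1, one_smul])⟩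
  · exact ⟨_, _, key (-1) (by rw [h1, neg_smul, one_smul])⟩

/-- `A²` commutes with `J`, so `A² = d + b J`. Since `A` commutes with `A²` but not with `J`, `b =
0`. A value `d ≥ 0` would make `A` a real scalar, which cannot anticommute with `J` unless it is
zero; so `d < 0` and scaling suffices. -/
theorem exists_smul_mul_self_eq_neg_one_of_anticommute [FiniteDimensional ℝ R] {J A : R}
    (hJ : J * J = -1) (h : A * J = -(J * A)) (hA : A ≠ 0) :
    ∃ a : ℝ, (a • A) * (a • A) = -1 := by
  have hJ0 : J ≠ 0 := by rintro rfl; simp at hJ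
  have hAJ : A * J ≠ 0 := mul_ne_zero hA hJ0
  obtain ⟨d, b, hd⟩ := eq_smul_one_add_smul_of_commute (A := A * A) hJ
    (by rw [mul_assoc, h, mul_neg, ← mul_assoc, h, neg_mul, neg_neg, mul_assoc])
  have hb : b = 0 := by
    have h1 : A * (A * A) = (A * A) * A := (mul_assoc _ _ _).symm
    rw [hd, mul_add, add_mul, mul_smul_comm, mul_smul_comm, smul_mul_assoc, smul_mul_assoc,
      mul_one, one_mul, add_right_inj, ← sub_eq_zero, ← smul_sub] at h1
    refine (smul_eq_zero.1 h1).resolve_right ?_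
    have : A * J - J * A = (2 : ℝ) • (A * J) := by rw [two_smul, sub_eq_add_neg, ← h]
    rw [this]
    exact smul_ne_zero two_ne_zero hAJ
  rw [hb, zero_smul, add_zero] at hd
  have hns : ∀ c : ℝ, A ≠ c • 1 := by
    rintro c rfl
    refine hAJ ?_
    have h2 : (c • (1 : R)) * J = -((c • (1 : R)) * J) := by
      nth_rw 1 [h]; simp
    rw [← sub_eq_zero, sub_neg_eq_add, ← two_smul ℝ] at h2
    exact (smul_eq_zero.1 h2).resolve_left two_ne_zero
  rcases le_or_gt 0 d with hd0 | hd0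
  · exfalso
    have h2 : (√d • (1 : R)) * (√d • 1) = d • 1 := by
      rw [smul_mul_smul_comm, Real.mul_self_sqrt hd0, one_mul]
    rcases (Commute.mul_self_eq_mul_self_iff (by simp [commute_iff_eq])).1 (hd.trans h2.symm) with h3 | h3
    · exact hns _ h3
    · exact hns (-√d) (by rw [h3, neg_smul])
  · refine ⟨(√(-d))⁻¹, ?_⟩
    have hs : (√(-d)) * (√(-d)) = -d := Real.mul_self_sqrt (by linarith)
    rw [smul_mul_smul_comm, hd, smul_smul, ← mul_inv, hs, inv_neg,
      neg_mul, inv_mul_cancel₀ hd0.ne, neg_smul, one_smul]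

end Domain

/-! ### Splitting into parts that commute and anticommute with a complex structure -/

section ComplexStructureIdentities

variable {R : Type*} [Ring R] {J K A B : R}

/-- Conjugation by `J` sends `A` to `-J A J`. Twice `A` is the sum of `A - J A J`, fixed by it, and
`A + J A J`, which it negates. -/
theorem anticommute_add_mul_mul (hJ : J * J = -1) :
    (A + J * A * J) * J = -(J * (A + J * A * J)) := by
  have h1 : J * A * J * J = -(J * A) := by rw [mul_assoc, hJ, mul_neg, mul_one]
  have h2 : J * (J * A * J) = -(A * J) := by
    rw [mul_assoc, ← mul_assoc, hJ, neg_one_mul]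
  rw [add_mul, mul_add, h1, h2]
  abel

theorem commute_sub_mul_mul (hJ : J * J = -1) :
    (A - J * A * J) * J = J * (A - J * A * J) := by
  have h1 : J * A * J * J = -(J * A) := by rw [mul_assoc, hJ, mul_neg, mul_one]
  have h2 : J * (J * A * J) = -(A * J) := by
    rw [mul_assoc, ← mul_assoc, hJ, neg_one_mul]
  rw [sub_mul, mul_sub, h1, h2]
  abel

theorem commute_of_add_mul_mul_eq_zero (hJ : J * J = -1) (h : A + J * A * J = 0) :
    A * J = J * A := by
  nth_rw 1 [eq_neg_of_add_eq_zero_left h]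
  rw [neg_mul, mul_assoc, hJ, mul_neg, mul_one, neg_neg]

theorem mul_commute_of_anticommute (hA : A * J = -(J * A)) (hB : B * J = -(J * B)) :
    (A * B) * J = J * (A * B) := by
  rw [mul_assoc, hB, mul_neg, ← mul_assoc, hA, neg_mul, neg_neg, mul_assoc]

theorem eq_of_mul_eq_smul_one_add_smul [Algebra ℝ R] (hK : K * K = -1) {r s : ℝ}
    (h : A * K = r • 1 + s • J) : A = -(r • K) - s • (J * K) := by
  have h1 := congrArg (· * K) h
  simp only [mul_assoc, hK, add_mul, smul_mul_assoc, one_mul, mul_neg, mul_one] at h1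
  rw [← neg_add', ← h1, neg_neg]

end ComplexStructureIdentities

/-- Two anticommuting complex structures make a real vector space quaternionic. -/
theorem four_dvd_finrank_of_anticommuting {V : Type*} [AddCommGroup V] [Module ℝ V]
    {J K : Module.End ℝ V} (hJ : J * J = -1) (hK : K * K = -1) (hJK : K * J = -(J * K)) :
    4 ∣ Module.finrank ℝ V := by
  let q : QuaternionAlgebra.Basis (Module.End ℝ V) (-1 : ℝ) 0 (-1) :=
    { i := J, j := K, k := J * K, i_mul_i := by simp [hJ], j_mul_j := by simp [hK]
      i_mul_j := rfl, j_mul_i := by simp [hJK] }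
  let f : Quaternion ℝ →ₐ[ℝ] Module.End ℝ V := q.liftHom
  let _ : Module (Quaternion ℝ) V := Module.compHom V f.toRingHom
  have : IsScalarTower ℝ (Quaternion ℝ) V :=
    ⟨fun r x v ↦ by
      change f (r • x) v = r • f x v
      rw [map_smul, LinearMap.smul_apply]⟩
  -- Over the division ring of quaternions `V` is free, so its real dimension is four times its
  -- quaternionic one.
  rw [← Module.finrank_mul_finrank ℝ (Quaternion ℝ) V, Quaternion.finrank_eq_four]
  exact dvd_mul_right _ _

/-! ### Self-adjoint elements of the commutant -/

section InvariantForms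

variable {V : Type*} [AddCommGroup V] [Module ℝ V]

/-- The endomorphisms in the commutant of `G` that are self-adjoint for the bilinear form `b`. -/
def selfAdjointCommutant (G : Subgroup (V ≃ₗ[ℝ] V)) (b : LinearMap.BilinForm ℝ V) :
    Submodule ℝ (commutant G) where
  carrier := {A | ∀ v w, b (A.1 v) w = b v (A.1 w)}
  add_mem' hA hA' v w := by
    have := congrArg₂ (· + ·) (hA v w) (hA' v w)
    simpa using this
  zero_mem' v w := by simp
  smul_mem' c A hA v w := by
    have := congrArg (c * ·) (hA v w)
    simpa using this

variable {G : Subgroup (V ≃ₗ[ℝ] V)} {b : LinearMap.BilinForm ℝ V}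

theorem one_mem_selfAdjointCommutant : (1 : commutant G) ∈ selfAdjointCommutant G b :=
  fun _ _ ↦ rfl

/-- Each form `B i` is `b (A i ·) ·` for a unique `A i`. Invariance of both forms makes `A i`
commute with `G`, symmetry of both makes it self-adjoint, and a linear relation among the `A i` is
one among the `B i`. -/
theorem le_finrank_selfAdjointCommutant [FiniteDimensional ℝ V] {k : ℕ}
    (hb : b.Nondegenerate) (hbsymm : ∀ v w, b v w = b w v)
    (hbG : ∀ ψ ∈ G, ∀ v w, b (ψ v) (ψ w) = b v w) {B : Fin k → LinearMap.BilinForm ℝ V}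
    (hB : ∀ c : Fin k → ℝ, (∀ v w, ∑ i, c i * B i v w = 0) → ∀ i, c i = 0) (hsymm : ∀ i v w, B i v w = B i w v)
    (hG : ∀ i, ∀ ψ ∈ G, ∀ v w, B i (ψ v) (ψ w) = B i v w) :
    k ≤ Module.finrank ℝ (selfAdjointCommutant G b) := by
  let A (i : Fin k) : Module.End ℝ V := (b.toDual hb).symm.toLinearMap ∘ₗ B i
  have hA (i v w) : b (A i v) w = B i v w := b.apply_toDual_symm_apply (hB := hb) (B i v) w
  have hAG (i) : A i ∈ commutant G := mem_commutant.2 fun ψ hψ v ↦ by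
    refine (b.toDual hb).injective (LinearMap.ext fun w ↦ ?_)
    obtain ⟨w, rfl⟩ := ψ.surjective w
    change b (A i (ψ v)) (ψ w) = b (ψ (A i v)) (ψ w)
    rw [hA, hG i ψ hψ, hbG ψ hψ, hA]
  have hAS (i) : (⟨A i, hAG i⟩ : commutant G) ∈ selfAdjointCommutant G b := fun v w ↦ by
    change b (A i v) w = b v (A i w)
    rw [hA, hbsymm, hA, hsymm]
  have hli : LinearIndependent ℝ
      (fun i ↦ (⟨⟨A i, hAG i⟩, hAS i⟩ : selfAdjointCommutant G b)) := by
    refine LinearIndependent.of_comp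
      ((commutant G).val.toLinearMap ∘ₗ (selfAdjointCommutant G b).subtype) ?_
    change LinearIndependent ℝ A
    refine Fintype.linearIndependent_iff.2 fun c hc ↦ hB c fun v w ↦ ?_
    have := congrArg (fun T : Module.End ℝ V ↦ b (T v) w) hc
    simpa [LinearMap.sum_apply, hA] using this
  simpa using hli.fintype_card_le_finrank

/-- This keeps both parts `A ± J A J` self-adjoint, although a product of self-adjoint elements need
not be. -/
theorem mul_mul_mem_selfAdjointCommutant {J A : commutant G}
    (hJ : J ∈ selfAdjointCommutant G b) (hA : A ∈ selfAdjointCommutant G b) :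
    J * A * J ∈ selfAdjointCommutant G b := fun v w ↦ by
  change b (J.1 (A.1 (J.1 v))) w = b v (J.1 (A.1 (J.1 w)))
  rw [hJ, hA, hJ]

variable [FiniteDimensional ℝ V] [Nontrivial V]

theorem exists_complexStructure_mem_selfAdjointCommutant (hG : ¬ ActsReducibly G)
    (h : 2 ≤ Module.finrank ℝ (selfAdjointCommutant G b)) :
    ∃ J ∈ selfAdjointCommutant G b, J * J = -1 := by
  have := noZeroDivisors_commutant hG
  by_cases hA : ∃ A ∈ selfAdjointCommutant G b, ∀ c : ℝ, A ≠ c • 1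
  · obtain ⟨A, hA, hc⟩ := hA
    obtain ⟨p, q, -, hpq⟩ := exists_smul_add_smul_one_mul_self_eq_neg_one hc
    exact ⟨_, add_mem (Submodule.smul_mem _ _ hA)
      (Submodule.smul_mem _ _ one_mem_selfAdjointCommutant), hpq⟩
  · push Not at hA
    have := (Submodule.finrank_mono (t := ℝ ∙ (1 : commutant G)) fun A hA' ↦ by
      obtain ⟨c, rfl⟩ := hA A hA'
      exact Submodule.smul_mem _ _ (Submodule.mem_span_singleton_self _)).trans
      (finrank_span_singleton one_ne_zero).le
    omega

theorem exists_quaternionStructure_mem_selfAdjointCommutant (hG : ¬ ActsReducibly G)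
    (h : 3 ≤ Module.finrank ℝ (selfAdjointCommutant G b)) :
    ∃ J ∈ selfAdjointCommutant G b, ∃ K ∈ selfAdjointCommutant G b,
      J * J = -1 ∧ K * K = -1 ∧ K * J = -(J * K) := by
  classical
  have := noZeroDivisors_commutant hG
  obtain ⟨J, hJ, hJJ⟩ := exists_complexStructure_mem_selfAdjointCommutant (b := b) hG (by omega)
  by_cases hA : ∃ A ∈ selfAdjointCommutant G b, A + J * A * J ≠ 0
  · obtain ⟨A, hA, h0⟩ := hA
    have hanti := anticommute_add_mul_mul (A := A) hJJ
    obtain ⟨c, hc⟩ := exists_smul_mul_self_eq_neg_one_of_anticommute hJJ hanti h0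
    refine ⟨J, hJ, c • (A + J * A * J), Submodule.smul_mem _ _
      (add_mem hA (mul_mul_mem_selfAdjointCommutant hJ hA)), hJJ, hc, ?_⟩
    rw [smul_mul_assoc, hanti, mul_smul_comm, smul_neg]
  -- If `A + J A J` always vanishes, every self-adjoint `A` commutes with `J` and lies in the span
  -- of `1` and `J`.
  · push Not at hA
    have := (Submodule.finrank_mono
      (t := Submodule.span ℝ (({1, J} : Finset (commutant G)) : Set (commutant G)))
      fun A hA' ↦ by
        have hcomm := commute_of_add_mul_mul_eq_zero hJJ (hA A hA')
        obtain ⟨p, q, rfl⟩ := eq_smul_one_add_smul_of_commute hJJ hcomm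
        exact add_mem (Submodule.smul_mem _ _ (Submodule.subset_span (by simp)))
          (Submodule.smul_mem _ _ (Submodule.subset_span (by simp)))).trans
      ((finrank_span_finset_le_card _).trans Finset.card_le_two)
    omega

/-- The part of `A` commuting with `J` lies in the span of `1, J`, and the anticommuting part in
that of `K, J K`. Self-adjointness removes the `J K` term. -/
theorem finrank_selfAdjointCommutant_le_three (hG : ¬ ActsReducibly G) (hb : b.SeparatingLeft) :
    Module.finrank ℝ (selfAdjointCommutant G b) ≤ 3 := by
  classical
  by_contra! h
  have := noZeroDivisors_commutant hG
  obtain ⟨J, hJ, K, hK, hJJ, hKK, hKJ⟩ :=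
    exists_quaternionStructure_mem_selfAdjointCommutant (b := b) hG (by omega)
  have hJK0 : J * K ≠ 0 := mul_ne_zero (by rintro rfl; simp at hJJ) (by rintro rfl; simp at hKK)
  have := (Submodule.finrank_mono
    (t := Submodule.span ℝ (({1, J, K} : Finset (commutant G)) : Set (commutant G)))
    fun A hA ↦ by
      have hJAJ := mul_mul_mem_selfAdjointCommutant hJ hA
      obtain ⟨p, q, hpq⟩ := eq_smul_one_add_smul_of_commute hJJ
        (commute_sub_mul_mul (A := A) hJJ)
      obtain ⟨r, s, hrs⟩ := eq_smul_one_add_smul_of_commute hJJ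
        (mul_commute_of_anticommute (anticommute_add_mul_mul (A := A) hJJ) hKJ)
      have h3 := eq_of_mul_eq_smul_one_add_smul hKK hrs
      -- Otherwise `J K` would be self-adjoint; but its adjoint is `K J = -J K`, so nondegeneracy
      -- would give `J K = 0`.
      have hs : s = 0 := by
        by_contra hs
        have hmem : s • (J * K) ∈ selfAdjointCommutant G b := by
          have : s • (J * K) = -(r • K) - (A + J * A * J) := by rw [h3]; abel
          rw [this]
          exact sub_mem (neg_mem (Submodule.smul_mem _ _ hK)) (add_mem hA hJAJ)
        have hmem' : J * K ∈ selfAdjointCommutant G b := by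
          have := Submodule.smul_mem _ s⁻¹ hmem
          rwa [smul_smul, inv_mul_cancel₀ hs, one_smul] at this
        refine hJK0 (Subtype.ext (LinearMap.ext fun v ↦ hb _ fun w ↦ ?_))
        have e1 : b ((J * K).1 v) w = b v ((J * K).1 w) := hmem' v w
        have e2 : b ((J * K).1 v) w = b v ((K * J).1 w) := by
          change b (J.1 (K.1 v)) w = b v (K.1 (J.1 w))
          rw [hJ, hK]
        have e3 : b v ((K * J).1 w) = - b v ((J * K).1 w) := by
          rw [hKJ]; simp
        linarith
      have h4 : A = (1 / 2 * p) • (1 : commutant G) + ((1 / 2 * q) • J + (-(1 / 2 * r)) • K) := by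
        have : A = (1 / 2 : ℝ) • ((A - J * A * J) + (A + J * A * J)) := by module
        rw [this, hpq, h3, hs]
        module
      rw [h4]
      exact add_mem (Submodule.smul_mem _ _ (Submodule.subset_span (by simp)))
        (add_mem (Submodule.smul_mem _ _ (Submodule.subset_span (by simp)))
          (Submodule.smul_mem _ _ (Submodule.subset_span (by simp))))).trans
    ((finrank_span_finset_le_card _).trans Finset.card_le_three)
  omega

end InvariantForms

/-! ### Forms with a self-adjoint complex structure -/

section ComplexStructure

variable {V : Type*} [AddCommGroup V] [Module ℝ V]
  {b : LinearMap.BilinForm ℝ V} {J : Module.End ℝ V}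

theorem finrank_map_of_mul_self_eq_neg_one (hJ : J * J = -1) (W : Submodule ℝ V) :
    Module.finrank ℝ (W.map J) = Module.finrank ℝ W := by
  have key (u : V) : J (J u) = -u := LinearMap.congr_fun hJ u
  have hinj : Function.Injective J := fun v w h ↦ by simpa [key] using congrArg J h
  exact (Submodule.equivMapOfInjective J hinj W).finrank_eq.symm

/-- A form for which a complex structure is self-adjoint has neutral signature. -/
theorem sigPos_toQuadraticMap_eq_sigNeg [FiniteDimensional ℝ V] (hJ : J * J = -1) (hb : ∀ v w, b (J v) w = b v (J w)) :
    sigPos (LinearMap.BilinMap.toQuadraticMap b) =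
      sigNeg (LinearMap.BilinMap.toQuadraticMap b) := by
  have key (u : V) : J (J u) = -u := LinearMap.congr_fun hJ u
  -- Thus `J` carries positive definite subspaces to negative definite ones of the same dimension,
  -- and conversely.
  have hneg (u : V) : b (J u) (J u) = - b u u := by rw [hb, key, map_neg]
  refine le_antisymm ?_ ?_
  · obtain ⟨W, hW, hpos⟩ := exists_finrank_eq_sigPos_and_posDef
      (LinearMap.BilinMap.toQuadraticMap b)
    rw [← hW, ← finrank_map_of_mul_self_eq_neg_one hJ W]
    refine le_sigNeg_of_negDef _ ?_
    rintro ⟨_, w, hw, rfl⟩ h0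
    have hw0 : (⟨w, hw⟩ : W) ≠ 0 := fun h ↦ h0 (by
      have : w = 0 := congrArg Subtype.val h
      simp [this])
    have := hpos ⟨w, hw⟩ hw0
    change 0 < b w w at this
    change 0 < -(b (J w) (J w))
    rwa [hneg, neg_neg]
  · obtain ⟨W, hW, hpos⟩ := exists_finrank_eq_sigNeg_and_negDef
      (LinearMap.BilinMap.toQuadraticMap b)
    rw [← hW, ← finrank_map_of_mul_self_eq_neg_one hJ W]
    refine le_sigPos_of_posDef _ ?_
    rintro ⟨_, w, hw, rfl⟩ h0
    have hw0 : (⟨w, hw⟩ : W) ≠ 0 := fun h ↦ h0 (by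
      have : w = 0 := congrArg Subtype.val h
      simp [this])
    have := hpos ⟨w, hw⟩ hw0
    change 0 < -(b w w) at this
    change 0 < b (J w) (J w)
    rwa [hneg]

/-- In dimension two, the isometries commuting with a self-adjoint complex structure are `±1`. -/
theorem actsReducibly_of_finrank_eq_two {G : Subgroup (V ≃ₗ[ℝ] V)}
    (hV : Module.finrank ℝ V = 2) (hnd : b.SeparatingLeft)
    (hbG : ∀ ψ ∈ G, ∀ v w, b (ψ v) (ψ w) = b v w)
    (hJ : J * J = -1) (hJG : J ∈ commutant G) (hb : ∀ v w, b (J v) w = b v (J w)) :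
    ActsReducibly G := by
  have key (u : V) : J (J u) = -u := LinearMap.congr_fun hJ u
  have : Nontrivial V := Module.nontrivial_of_finrank_pos (R := ℝ) (by omega)
  obtain ⟨v, hv⟩ := exists_ne (0 : V)
  have hli : LinearIndependent ℝ ![v, J v] := by
    refine (LinearIndependent.pair_iff' hv).2 fun c hc ↦ ?_
    have h1 : (c * c + 1) • v = 0 := by
      rw [add_smul, mul_smul, hc, ← map_smul, hc, key, one_smul, neg_add_cancel]
    exact hv ((smul_eq_zero.1 h1).resolve_left (by nlinarith [mul_self_nonneg c]))
  have hspan : ∀ w, ∃ p q : ℝ, p • v + q • J v = w := fun w ↦ by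
    have htop := hli.span_eq_top_of_card_eq_finrank (by simp [hV])
    have hw : w ∈ Submodule.span ℝ (range ![v, J v]) := htop ▸ Submodule.mem_top
    rw [Matrix.range_cons_cons_empty] at hw
    exact Submodule.mem_span_pair.1 hw
  refine ⟨ℝ ∙ v, by simpa using hv, fun h ↦ ?_, fun ψ hψ w hw ↦ ?_⟩
  · have h1 := finrank_span_singleton (K := ℝ) hv
    rw [h, finrank_top, hV] at h1
    omega
  · obtain ⟨p, q, hpq⟩ := hspan (ψ v)
    have hψJ : ψ (J v) = p • J v - q • v := by
      rw [← mem_commutant.1 hJG ψ hψ, ← hpq, map_add, map_smul, map_smul, key, smul_neg,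
        sub_eq_add_neg]
    have h1 := hbG ψ hψ v v
    have h2 := hbG ψ hψ v (J v)
    have h3 : b (J v) (J v) = -b v v := by rw [hb, key, map_neg]
    rw [hψJ, ← hpq] at h2
    rw [← hpq] at h1
    simp only [map_add, map_sub, map_smul, LinearMap.add_apply, LinearMap.smul_apply,
      smul_eq_mul, hb v v, h3] at h1 h2
    have hne : b v v ≠ 0 ∨ b v (J v) ≠ 0 := by
      by_contra! h0
      refine hv (hnd v fun w ↦ ?_)
      obtain ⟨r, s, rfl⟩ := hspan w
      rw [map_add, map_smul, map_smul, h0.1, h0.2, smul_zero, smul_zero, add_zero]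
    have hpos : 0 < b v v ^ 2 + b v (J v) ^ 2 := by
      rcases hne with h | h
      · exact add_pos_of_pos_of_nonneg (sq_pos_iff.2 h) (sq_nonneg _)
      · exact add_pos_of_nonneg_of_pos (sq_nonneg _) (sq_pos_iff.2 h)
    -- With `λ = p + q i` and `β = b v v - i b v (J v)`, the relations `h1` and `h2` say `λ² β = β`.
    -- Multiplying `λ² - 1` by `|β|² > 0` and taking real and imaginary parts gives `p² - q² = 1`
    -- and `p q = 0`.
    have hq : q = 0 := by
      have e1 : (p ^ 2 - q ^ 2 - 1) * (b v v ^ 2 + b v (J v) ^ 2) = 0 := by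
        linear_combination b v v * h1 + b v (J v) * h2
      have e2 : (p * q) * (b v v ^ 2 + b v (J v) ^ 2) = 0 := by
        linear_combination (b v (J v) * h1 - b v v * h2) / 2
      have e1' := (mul_eq_zero.1 e1).resolve_right hpos.ne'
      rcases mul_eq_zero.1 ((mul_eq_zero.1 e2).resolve_right hpos.ne') with h | h
      · rw [h] at e1'
        nlinarith [sq_nonneg q]
      · exact h
    obtain ⟨r, rfl⟩ := Submodule.mem_span_singleton.1 hw
    rw [hq, zero_smul, add_zero] at hpq
    rw [map_smul, ← hpq]
    exact Submodule.smul_mem _ _ (Submodule.smul_mem _ _ (Submodule.mem_span_singleton_self v))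

end ComplexStructure

/-! ### Metrics and connections in the frame of a chart -/

section LocalForm

/-- A family of bilinear forms on a Euclidean space is smooth if its values are. -/
theorem contMDiffAt_bilinForm_of_apply {n : ℕ} {M : Type*} [TopologicalSpace M]
    [ChartedSpace (EuclideanSpace ℝ (Fin n)) M]
    {f : M → EuclideanSpace ℝ (Fin n) →L[ℝ] EuclideanSpace ℝ (Fin n) →L[ℝ] ℝ} {y : M}
    (h : ∀ a b, ContMDiffAt (𝓡 n) 𝓘(ℝ, ℝ) ∞ (fun x ↦ f x a b) y) :
    ContMDiffAt (𝓡 n) 𝓘(ℝ, EuclideanSpace ℝ (Fin n) →L[ℝ] EuclideanSpace ℝ (Fin n) →L[ℝ] ℝ) ∞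
      f y := by
  let e := EuclideanSpace.basisFun (Fin n) ℝ
  let p (i : Fin n) : EuclideanSpace ℝ (Fin n) →L[ℝ] ℝ := EuclideanSpace.proj i
  have hf : f = fun x ↦ ∑ i, ∑ j, f x (e i) (e j) • (p i).smulRight (p j) := by
    funext x
    ext a b
    have ha : a = ∑ i, a i • e i := by simpa [e] using (e.sum_repr a).symm
    have hb : b = ∑ i, b i • e i := by simpa [e] using (e.sum_repr b).symm
    have : f x a b = f x (∑ i, a i • e i) (∑ i, b i • e i) := by rw [← ha, ← hb]
    rw [this]
    simp only [map_sum, map_smul, sum_apply, smul_apply, smul_eq_mul, ContinuousLinearMap.smulRight_apply,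
      p, PiLp.proj_apply, Finset.mul_sum]
    rw [Finset.sum_comm]
    exact Finset.sum_congr rfl fun i _ ↦ Finset.sum_congr rfl fun j _ ↦ by ring
  rw [hf]
  refine ContMDiffAt.sum fun i _ ↦ ContMDiffAt.sum fun j _ ↦ ?_
  exact (h (e i) (e j)).smul contMDiffAt_const

variable {n : ℕ} {M : Type*} [TopologicalSpace M]
  [ChartedSpace (EuclideanSpace ℝ (Fin n)) M] [IsManifold (𝓡 n) ∞ M]

/-- The trivialization of the tangent bundle given by the chart at `z`. -/
noncomputable abbrev tangentTriv (n : ℕ) {M : Type*} [TopologicalSpace M]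
    [ChartedSpace (EuclideanSpace ℝ (Fin n)) M] [IsManifold (𝓡 n) ∞ M] (z : M) :=
  trivializationAt (EuclideanSpace ℝ (Fin n)) (TangentSpace (𝓡 n) : M → Type _) z

/-- The vector field with constant coefficients `a` in the frame of the chart at `z`. -/
noncomputable def constField (z : M) (a : EuclideanSpace ℝ (Fin n)) (y : M) :
    TangentSpace (𝓡 n) y :=
  (tangentTriv n z).symmL ℝ y a

theorem contMDiffAt_constField {z y : M} (hy : y ∈ (tangentTriv n z).baseSet)
    (a : EuclideanSpace ℝ (Fin n)) :
    ContMDiffAt (𝓡 n) (𝓡 n).tangent ∞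
      (fun y ↦ (⟨y, constField z a y⟩ : TangentBundle (𝓡 n) M)) y := by
  rw [(tangentTriv n z).contMDiffAt_section_iff hy]
  refine (contMDiffAt_const (c := a)).congr_of_eventuallyEq ?_
  filter_upwards [(tangentTriv n z).open_baseSet.mem_nhds hy] with x hx
  rw [constField, (tangentTriv n z).symmL_apply hx]
  exact congrArg Prod.snd ((tangentTriv n z).apply_mk_symm hx a)

/-- The matrix of the metric `g` in the frame of the chart at `z`. -/
noncomputable def SemiRiemannianMetric.localForm (g : SemiRiemannianMetric n M) (z y : M) :
    EuclideanSpace ℝ (Fin n) →L[ℝ] EuclideanSpace ℝ (Fin n) →L[ℝ] ℝ :=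
  ((tangentTriv n z).symmL ℝ y).precomp ℝ ∘L (g.toFun y) ∘L (tangentTriv n z).symmL ℝ y

theorem SemiRiemannianMetric.localForm_apply (g : SemiRiemannianMetric n M) (z y : M)
    (a b : EuclideanSpace ℝ (Fin n)) :
    g.localForm z y a b = g.toFun y (constField z a y) (constField z b y) := rfl

theorem SemiRiemannianMetric.contMDiffAt_localForm (g : SemiRiemannianMetric n M) {z y : M}
    (hy : y ∈ (tangentTriv n z).baseSet) :
    ContMDiffAt (𝓡 n) 𝓘(ℝ, EuclideanSpace ℝ (Fin n) →L[ℝ] EuclideanSpace ℝ (Fin n) →L[ℝ] ℝ) ∞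
      (g.localForm z) y := by
  refine contMDiffAt_bilinForm_of_apply fun a b ↦ ?_
  have h := ContMDiffAt.clm_bundle_apply₂ (F₁ := EuclideanSpace ℝ (Fin n))
    (F₂ := EuclideanSpace ℝ (Fin n)) (F₃ := ℝ) (E₃ := Bundle.Trivial M ℝ)
    (b := id) (g.smooth y) (contMDiffAt_constField hy a) (contMDiffAt_constField hy b)
  simp only [contMDiffAt_totalSpace] at h
  exact h.2

theorem mdifferentiableAt_constField {z y : M} (hy : y ∈ (tangentTriv n z).baseSet)
    (a : EuclideanSpace ℝ (Fin n)) :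
    MDifferentiableAt (𝓡 n) (𝓡 n).tangent
      (fun y ↦ (⟨y, constField z a y⟩ : TangentBundle (𝓡 n) M)) y :=
  (contMDiffAt_constField hy a).mdifferentiableAt (by simp)

/-- The coefficients of a tangent vector in the frame of the chart at `z`. -/
noncomputable def coeff (z y : M) : TangentSpace (𝓡 n) y →L[ℝ] EuclideanSpace ℝ (Fin n) :=
  (tangentTriv n z).continuousLinearMapAt ℝ y

theorem coeff_apply {z y : M} (hy : y ∈ (tangentTriv n z).baseSet) (v : TangentSpace (𝓡 n) y) :
    coeff z y v = ((tangentTriv n z) ⟨y, v⟩).2 :=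
  congrFun ((tangentTriv n z).coe_linearMapAt_of_mem (R := ℝ) hy) v

theorem constField_coeff {z y : M} (hy : y ∈ (tangentTriv n z).baseSet)
    (v : TangentSpace (𝓡 n) y) : constField z (coeff z y v) y = v :=
  (tangentTriv n z).symmL_continuousLinearMapAt hy v

theorem SemiRiemannianMetric.apply_eq_localForm (g : SemiRiemannianMetric n M) {z y : M}
    (hy : y ∈ (tangentTriv n z).baseSet) (v w : TangentSpace (𝓡 n) y) :
    g.toFun y v w = g.localForm z y (coeff z y v) (coeff z y w) := by
  rw [g.localForm_apply, constField_coeff hy, constField_coeff hy]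

/-- The two fields agree near `x`, and a covariant derivative is local. This links the definition of
parallel fields to fields with constant coefficients. -/
theorem LinearConnection.cov_extend (D : LinearConnection n M) {x : M}
    (v : TangentSpace (𝓡 n) x) :
    D.cov (FiberBundle.extend (EuclideanSpace ℝ (Fin n)) v) x =
      D.cov (constField x (coeff x x v)) x := by
  have hx : x ∈ (tangentTriv n x).baseSet := FiberBundle.mem_baseSet_trivializationAt' x
  refine D.cov.isCovariantDerivativeOnUniv.congr_of_eventuallyEq
    (FiberBundle.mdifferentiableAt_extend (𝓡 n) _ v) (mdifferentiableAt_constField hx _)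
    Filter.univ_mem ?_
  filter_upwards [(tangentTriv n x).open_baseSet.mem_nhds hx] with y hy
  rw [constField, (tangentTriv n x).symmL_apply hy, coeff_apply hx]
  rfl

set_option synthInstance.maxHeartbeats 200000 in
/-- The derivative of the matrix of a parallel metric. -/
theorem SemiRiemannianMetric.IsParallel.mfderiv_localForm {g : SemiRiemannianMetric n M}
    {D : LinearConnection n M} (h : g.IsParallel D) {z y : M}
    (hy : y ∈ (tangentTriv n z).baseSet) (X : TangentSpace (𝓡 n) y)
    (a b : EuclideanSpace ℝ (Fin n)) :
    mvfderiv (𝓡 n) (g.localForm z) y X a b =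
      g.localForm z y (coeff z y (D.cov (constField z a) y X)) b +
        g.localForm z y a (coeff z y (D.cov (constField z b) y X)) := by
  have hpar := h y X _ _ (mdifferentiableAt_constField hy a) (mdifferentiableAt_constField hy b)
  rw [g.localForm_apply, g.localForm_apply, constField_coeff hy, constField_coeff hy, ← hpar]
  have hL := ((g.contMDiffAt_localForm hy).mdifferentiableAt (by simp)).hasMFDerivAt
  let ev : (EuclideanSpace ℝ (Fin n) →L[ℝ] EuclideanSpace ℝ (Fin n) →L[ℝ] ℝ) →L[ℝ] ℝ :=
    ContinuousLinearMap.apply ℝ ℝ b ∘L ContinuousLinearMap.apply ℝ _ a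
  have hc := ev.hasMFDerivAt.comp y hL
  have hd := hc.mfderiv
  change _ = mfderiv (𝓡 n) 𝓘(ℝ, ℝ) (ev ∘ g.localForm z) y X
  rw [hd]
  rfl

end LocalForm

/-! ### Parallel translation preserves parallel metrics -/

section ParallelTranslation

variable {n : ℕ} {M : Type*} [TopologicalSpace M]
  [ChartedSpace (EuclideanSpace ℝ (Fin n)) M] [IsManifold (𝓡 n) ∞ M]

set_option synthInstance.maxHeartbeats 200000 in
theorem SemiRiemannianMetric.hasDerivWithinAt_localForm_comp (g : SemiRiemannianMetric n M)
    {z : M} {γ : ℝ → M} {s : Set ℝ} {t : ℝ} (hy : γ t ∈ (tangentTriv n z).baseSet)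
    (hγ : MDifferentiableWithinAt 𝓘(ℝ) (𝓡 n) γ s t) :
    HasDerivWithinAt (fun u ↦ g.localForm z (γ u))
      (mvfderiv (𝓡 n) (g.localForm z) (γ t) (mfderivWithin 𝓘(ℝ) (𝓡 n) γ s t (1 : ℝ))) s t := by
  have hL := ((g.contMDiffAt_localForm hy).mdifferentiableAt (by simp)).hasMFDerivAt
  have hc := hL.comp_hasMFDerivWithinAt t hγ.hasMFDerivWithinAt
  have hd : HasFDerivWithinAt (fun u ↦ g.localForm z (γ u))
      ((mvfderiv (𝓡 n) (g.localForm z) (γ t)).comp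
        (show ℝ →L[ℝ] TangentSpace (𝓡 n) (γ t) from mfderivWithin 𝓘(ℝ) (𝓡 n) γ s t)) s t :=
    hc.hasFDerivWithinAt
  exact hd.hasDerivWithinAt

set_option synthInstance.maxHeartbeats 200000 in
/-- A parallel metric is constant on parallel vector fields along a curve. -/
theorem SemiRiemannianMetric.IsParallel.hasDerivWithinAt_along {g : SemiRiemannianMetric n M}
    {D : LinearConnection n M} (h : g.IsParallel D) {γ : ℝ → M} {s : Set ℝ} {t : ℝ} (ht : t ∈ s)
    (hγ : MDifferentiableWithinAt 𝓘(ℝ) (𝓡 n) γ s t) {V W : ∀ u : ℝ, TangentSpace (𝓡 n) (γ u)}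
    (hV : D.HasCovDerivAlongWithinAt γ V s t 0) (hW : D.HasCovDerivAlongWithinAt γ W s t 0) :
    HasDerivWithinAt (fun u ↦ g.toFun (γ u) (V u) (W u)) 0 s t := by
  have hx : γ t ∈ (tangentTriv n (γ t)).baseSet := FiberBundle.mem_baseSet_trivializationAt' _
  have hG := g.hasDerivWithinAt_localForm_comp hx hγ
  set X : TangentSpace (𝓡 n) (γ t) := mfderivWithin 𝓘(ℝ) (𝓡 n) γ s t (1 : ℝ) with hX
  have key {U : ∀ u : ℝ, TangentSpace (𝓡 n) (γ u)} (hU : D.HasCovDerivAlongWithinAt γ U s t 0) :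
      HasDerivWithinAt (fun u ↦ ((tangentTriv n (γ t)) ⟨γ u, U u⟩).2)
        (-coeff (γ t) (γ t)
          (D.cov (constField (γ t) (coeff (γ t) (γ t) (U t))) (γ t) X)) s t := by
    refine HasDerivWithinAt.congr_deriv hU ?_
    rw [← coeff_apply hx, D.cov_extend, zero_sub, map_neg]
  -- Product rule: `∇ g = 0` expresses the derivative of the matrix by two connection terms, which
  -- cancel those from the coefficients of `V` and `W`.
  have hf := (hG.clm_apply (key hV)).clm_apply (key hW)
  have heq : (fun u ↦ g.toFun (γ u) (V u) (W u)) =ᶠ[𝓝[s] t] fun u ↦ g.localForm (γ t) (γ u)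
      ((tangentTriv n (γ t)) ⟨γ u, V u⟩).2 ((tangentTriv n (γ t)) ⟨γ u, W u⟩).2 := by
    filter_upwards [hγ.continuousWithinAt.preimage_mem_nhdsWithin
      ((tangentTriv n (γ t)).open_baseSet.mem_nhds hx)] with u hu
    rw [g.apply_eq_localForm hu, coeff_apply hu, coeff_apply hu]
  refine (hf.congr_of_eventuallyEq_of_mem heq ht).congr_deriv ?_
  rw [← coeff_apply hx, ← coeff_apply hx, add_apply, h.mfderiv_localForm hx, map_neg, map_neg,
    neg_apply]
  ring

theorem SemiRiemannianMetric.IsParallel.eq_of_isParallelTranslationAlong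
    {g : SemiRiemannianMetric n M} {D : LinearConnection n M} (h : g.IsParallel D) {γ : ℝ → M}
    {x y : M} {τ : TangentSpace (𝓡 n) x ≃ₗ[ℝ] TangentSpace (𝓡 n) y}
    (hτ : D.IsParallelTranslationAlong γ x y τ) (v w : TangentSpace (𝓡 n) x) :
    g.toFun y (τ v) (τ w) = g.toFun x v w := by
  obtain ⟨hγ, rfl, rfl, hV⟩ := hτ
  obtain ⟨V, hVp, hV0, hV1⟩ := hV v
  obtain ⟨W, hWp, hW0, hW1⟩ := hV w
  have e (t : ℝ) {a b : TangentSpace (𝓡 n) (γ t)}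
      (hab : (⟨γ t, a⟩ : TangentBundle (𝓡 n) M) = ⟨γ t, b⟩) : a = b := by
    simpa using hab
  rw [← e 0 hV0, ← e 0 hW0] at *
  rw [← e 1 hV1, ← e 1 hW1]
  have hd (t : ℝ) (ht : t ∈ Icc (0 : ℝ) 1) :=
    h.hasDerivWithinAt_along ht (hγ.mdifferentiableOn one_ne_zero t ht) (hVp t ht) (hWp t ht)
  refine constant_of_derivWithin_zero (fun t ht ↦ (hd t ht).differentiableWithinAt)
    (fun t ht ↦ ?_) 1 (by simp)
  have ht' := Ico_subset_Icc_self ht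
  exact (hd t ht').derivWithin (uniqueDiffOn_Icc_zero_one t ht')

theorem SemiRiemannianMetric.IsParallel.eq_of_isParallelTranslation
    {g : SemiRiemannianMetric n M} {D : LinearConnection n M} (h : g.IsParallel D)
    {x y : M} {τ : TangentSpace (𝓡 n) x ≃ₗ[ℝ] TangentSpace (𝓡 n) y}
    (hτ : D.IsParallelTranslation x y τ) (v w : TangentSpace (𝓡 n) x) :
    g.toFun y (τ v) (τ w) = g.toFun x v w := by
  induction hτ with
  | of_curve γ hγ => exact h.eq_of_isParallelTranslationAlong hγ v w
  | concat _ _ ih ih' => exact (ih' _ _).trans (ih v w)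

end ParallelTranslation

/-! ### Continuity of the Christoffel matrices -/

section LocalForm

variable {n : ℕ} {M : Type*} [TopologicalSpace M]
  [ChartedSpace (EuclideanSpace ℝ (Fin n)) M] [IsManifold (𝓡 n) ∞ M]

/-- Smoothness of the connection is tested on globally smooth fields, while `constField z a` is
smooth only over the chart. A bump function equal to `1` near `y` makes it global without changing
its derivative there. -/
theorem LinearConnection.continuousAt_coeff_cov_constField [T2Space M] (D : LinearConnection n M)
    {z y : M} (hy : y ∈ (tangentTriv n z).baseSet) (a ξ : EuclideanSpace ℝ (Fin n)) :
    ContinuousAt (fun x ↦ coeff z x (D.cov (constField z a) x (constField z ξ x))) y := by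
  obtain ⟨f, hf⟩ : ∃ f : SmoothBumpFunction (𝓡 n) y, tsupport f ⊆ (tangentTriv n z).baseSet := by
    obtain ⟨f, -, hf⟩ := (SmoothBumpFunction.nhds_basis_tsupport (I := 𝓡 n) y).mem_iff.1
      ((tangentTriv n z).open_baseSet.mem_nhds hy)
    exact ⟨f, hf⟩
  let σ : ∀ x : M, TangentSpace (𝓡 n) x := fun x ↦ f x • constField z a x
  have hσ : ContMDiff (𝓡 n) (𝓡 n).tangent ∞ (fun x ↦ (⟨x, σ x⟩ : TangentBundle (𝓡 n) M)) := by
    intro x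
    by_cases hx : x ∈ tsupport f
    · exact f.contMDiffAt.smul_section (contMDiffAt_constField (hf hx) a)
    · have h0 : (fun x ↦ (⟨x, σ x⟩ : TangentBundle (𝓡 n) M)) =ᶠ[𝓝 x]
          fun x ↦ ⟨x, (0 : TangentSpace (𝓡 n) x)⟩ := by
        filter_upwards [(isClosed_tsupport f).isOpen_compl.mem_nhds hx] with x' hx'
        have : f x' = 0 := image_eq_zero_of_notMem_tsupport hx'
        simp [σ, this]
      exact (contMDiff_zeroSection ℝ (TangentSpace (𝓡 n) : M → Type _) x).congr_of_eventuallyEq h0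
  have hcov := D.smooth.contMDiff.contMDiff (σ := σ) hσ.contMDiffOn
  have hcov' := (hcov y (mem_univ y)).contMDiffAt Filter.univ_mem
  have happ := hcov'.clm_bundle_apply (E₁ := fun x : M ↦ TangentSpace (𝓡 n) x)
    (E₂ := fun x : M ↦ TangentSpace (𝓡 n) x) (b := id) (contMDiffAt_constField hy ξ)
  have hcont := (((tangentTriv n z).contMDiffAt_section_iff hy).1 happ).continuousAt
  refine hcont.congr ?_
  filter_upwards [(tangentTriv n z).open_baseSet.mem_nhds hy, f.eventuallyEq_one.eventually_nhds]
    with x hx hx1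
  rw [coeff_apply hx]
  have : D.cov σ x = D.cov (constField z a) x := by
    refine D.cov.isCovariantDerivativeOnUniv.congr_of_eventuallyEq
      ((hσ x).mdifferentiableAt (by simp)) (mdifferentiableAt_constField hx _)
      Filter.univ_mem ?_
    filter_upwards [hx1] with x' hx'
    simp [σ, hx']
  rw [← this]

/-- The matrix of `a ↦ ∇_ξ a` in the frame of the chart at `z`, where `ξ` and `a` are extended with
constant coefficients. -/
noncomputable def LinearConnection.christoffel (D : LinearConnection n M) (z : M)
    (ξ : EuclideanSpace ℝ (Fin n)) (y : M) :
    EuclideanSpace ℝ (Fin n) →L[ℝ] EuclideanSpace ℝ (Fin n) :=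
  ∑ i, (EuclideanSpace.proj i : EuclideanSpace ℝ (Fin n) →L[ℝ] ℝ).smulRight
    (coeff z y (D.cov (constField z (EuclideanSpace.basisFun (Fin n) ℝ i)) y (constField z ξ y)))

/-- Linearity of `∇` in the field requires differentiability, hence the restriction to the base set;
`christoffel` itself is built from the basis fields alone and is linear everywhere. -/
theorem LinearConnection.christoffel_apply (D : LinearConnection n M) {z y : M}
    (hy : y ∈ (tangentTriv n z).baseSet) (ξ a : EuclideanSpace ℝ (Fin n)) :
    D.christoffel z ξ y a = coeff z y (D.cov (constField z a) y (constField z ξ y)) := by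
  let L : EuclideanSpace ℝ (Fin n) →ₗ[ℝ] EuclideanSpace ℝ (Fin n) :=
    { toFun := fun a ↦ coeff z y (D.cov (constField z a) y (constField z ξ y))
      map_add' := fun a b ↦ by
        have : constField z (a + b) = constField (n := n) (M := M) z a + constField z b :=
          funext fun x ↦ map_add _ a b
        rw [this, D.cov.isCovariantDerivativeOnUniv.add (mdifferentiableAt_constField hy a)
          (mdifferentiableAt_constField hy b), add_apply, map_add]
      map_smul' := fun c a ↦ by
        have : constField z (c • a) = c • constField (n := n) (M := M) z a :=
          funext fun x ↦ map_smul _ c a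
        rw [this, D.cov.isCovariantDerivativeOnUniv.smul_const c
          (mdifferentiableAt_constField hy a), smul_apply, map_smul, RingHom.id_apply] }
  change _ = L a
  have ha : a = ∑ i, a i • EuclideanSpace.basisFun (Fin n) ℝ i := by
    simpa using ((EuclideanSpace.basisFun (Fin n) ℝ).sum_repr a).symm
  have hL : L a = ∑ i, a i • L (EuclideanSpace.basisFun (Fin n) ℝ i) := by
    conv_lhs => rw [ha]
    rw [map_sum]
    simp only [map_smul]
  rw [hL, christoffel, sum_apply]
  rfl

theorem LinearConnection.continuousOn_christoffel [T2Space M] (D : LinearConnection n M) (z : M)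
    (ξ : EuclideanSpace ℝ (Fin n)) :
    ContinuousOn (D.christoffel z ξ) (tangentTriv n z).baseSet := by
  rw [continuousOn_clm_apply]
  intro a y hy
  refine ContinuousAt.continuousWithinAt ?_
  refine (D.continuousAt_coeff_cov_constField hy a ξ).congr ?_
  filter_upwards [(tangentTriv n z).open_baseSet.mem_nhds hy] with x hx
  rw [D.christoffel_apply hx]

theorem SemiRiemannianMetric.IsParallel.mvfderiv_localForm_constField
    {g : SemiRiemannianMetric n M} {D : LinearConnection n M} (h : g.IsParallel D) {z y : M}
    (hy : y ∈ (tangentTriv n z).baseSet) (ξ a b : EuclideanSpace ℝ (Fin n)) :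
    mvfderiv (𝓡 n) (g.localForm z) y (constField z ξ y) a b =
      g.localForm z y (D.christoffel z ξ y a) b + g.localForm z y a (D.christoffel z ξ y b) := by
  rw [h.mfderiv_localForm hy, D.christoffel_apply hy, D.christoffel_apply hy]

end LocalForm

/-! ### Uniqueness for the linear equation of parallel forms -/

section Gronwall

variable {F : Type*} [NormedAddCommGroup F] [NormedSpace ℝ F] {k : ℕ}

theorem hasDerivAt_sum_smul {f : Fin k → ℝ → F} {f' : Fin k → F} {c : Fin k → ℝ} {t : ℝ}
    (h : ∀ i, HasDerivWithinAt (f i) (f' i) univ t) :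
    HasDerivAt (fun t ↦ ∑ i, c i • f i t) (∑ i, c i • f' i) t :=
  HasDerivAt.fun_sum fun i _ ↦ (hasDerivWithinAt_univ.1 (h i)).fun_const_smul (c i)

set_option synthInstance.maxHeartbeats 200000 in
set_option maxHeartbeats 1000000 in
/-- Uniqueness for the linear differential equation satisfied by parallel bilinear forms. -/
theorem sum_smul_eq_zero_of_hasDerivWithinAt {u u' : Fin k → ℝ → F →L[ℝ] F →L[ℝ] ℝ}
    {Γ : ℝ → F →L[ℝ] F} {c : Fin k → ℝ} (hΓ : ContinuousOn Γ (Icc 0 1))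
    (hu : ∀ i, ∀ t ∈ Icc (0 : ℝ) 1, HasDerivWithinAt (u i) (u' i t) univ t)
    (hu' : ∀ i, ∀ t ∈ Icc (0 : ℝ) 1, ∀ a b, u' i t a b = u i t (Γ t a) b + u i t a (Γ t b))
    (h0 : ∑ i, c i • u i 0 = 0) : ∑ i, c i • u i 1 = 0 := by
  obtain ⟨C, hC⟩ := isCompact_Icc.exists_bound_of_continuousOn hΓ
  have hd (t) (h : t ∈ Icc (0 : ℝ) 1) :
      HasDerivAt (fun t ↦ ∑ i, c i • u i t) (∑ i, c i • u' i t) t :=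
    hasDerivAt_sum_smul (F := F →L[ℝ] F →L[ℝ] ℝ) fun i ↦ hu i t h
  -- Each of the two slots contributes a factor `C`, a bound for `‖Γ‖` on the interval; Grönwall's
  -- inequality then applies.
  have hbound (t) (h : t ∈ Icc (0 : ℝ) 1) :
      ‖∑ i, c i • u' i t‖ ≤ (2 * C) * ‖∑ i, c i • u i t‖ := by
    have hC0 : 0 ≤ C := (norm_nonneg _).trans (hC t h)
    refine ContinuousLinearMap.opNorm_le_bound₂ _ (by positivity) fun a b ↦ ?_
    have e : (∑ i, c i • u' i t) a b =
        (∑ i, c i • u i t) (Γ t a) b + (∑ i, c i • u i t) a (Γ t b) := by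
      simp only [sum_apply, smul_apply, smul_eq_mul, hu' _ t h, mul_add, Finset.sum_add_distrib]
    have hΓ' (x) : ‖Γ t x‖ ≤ C * ‖x‖ := (Γ t).le_of_opNorm_le (hC t h) x
    rw [e]
    set U := ∑ i, c i • u i t
    calc _ ≤ ‖U (Γ t a) b‖ + ‖U a (Γ t b)‖ := norm_add_le _ _
      _ ≤ ‖U‖ * ‖Γ t a‖ * ‖b‖ + ‖U‖ * ‖a‖ * ‖Γ t b‖ :=
          add_le_add (U.le_opNorm₂ _ _) (U.le_opNorm₂ _ _)
      _ ≤ ‖U‖ * (C * ‖a‖) * ‖b‖ + ‖U‖ * ‖a‖ * (C * ‖b‖) := by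
          gcongr <;> exact hΓ' _
      _ = 2 * C * ‖U‖ * ‖a‖ * ‖b‖ := by ring
  exact eq_zero_of_abs_deriv_le_mul_abs_self_of_eq_zero_right (E := F →L[ℝ] F →L[ℝ] ℝ)
    (f := fun t ↦ ∑ i, c i • u i t) (f' := fun t ↦ ∑ i, c i • u' i t)
    (fun t h ↦ (hd t h).continuousAt.continuousWithinAt)
    (fun t h ↦ (hd t (Ico_subset_Icc_self h)).hasDerivWithinAt) h0
    (fun t h ↦ hbound t (Ico_subset_Icc_self h)) 1 (by simp)

theorem continuousAt_sum_smul {X : Type*} [TopologicalSpace X] {f : Fin k → X → F} {c : Fin k → ℝ}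
    {x : X} (h : ∀ i, ContinuousAt (f i) x) : ContinuousAt (fun y ↦ ∑ i, c i • f i y) x :=
  tendsto_finsetSum _ fun i _ ↦ (h i).const_smul (c i)

end Gronwall

/-! ### Vanishing at a point implies vanishing everywhere -/

section Propagation

variable {n : ℕ} {M : Type*} [TopologicalSpace M]
  [ChartedSpace (EuclideanSpace ℝ (Fin n)) M] [IsManifold (𝓡 n) ∞ M]

/-- Coordinate lines have constant velocity in the frame of the chart. -/
theorem mdifferentiableWithinAt_coordLine {z : M} {p ξ : EuclideanSpace ℝ (Fin n)} {t : ℝ}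
    (ht : p + t • ξ ∈ (extChartAt (𝓡 n) z).target) :
    MDifferentiableWithinAt 𝓘(ℝ) (𝓡 n) (fun s : ℝ ↦ (extChartAt (𝓡 n) z).symm (p + s • ξ)) univ t ∧
    mfderivWithin 𝓘(ℝ) (𝓡 n) (fun s : ℝ ↦ (extChartAt (𝓡 n) z).symm (p + s • ξ)) univ t (1 : ℝ) =
      constField z ξ ((extChartAt (𝓡 n) z).symm (p + t • ξ)) := by
  have h1 := (mdifferentiableWithinAt_extChartAt_symm (I := 𝓡 n) ht).hasMFDerivWithinAt
  have hsrc : (extChartAt (𝓡 n) z).symm (p + t • ξ) ∈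
      (chartAt (EuclideanSpace ℝ (Fin n)) z).source := by
    rw [← extChartAt_source (𝓡 n)]
    exact (extChartAt (𝓡 n) z).map_target ht
  have h2 := TangentBundle.symmL_trivializationAt (I := 𝓡 n) hsrc
  rw [(extChartAt (𝓡 n) z).right_inv ht] at h2
  have h3 : HasDerivAt (fun s : ℝ ↦ p + s • ξ) ξ t := by
    simpa using ((hasDerivAt_id t).smul_const ξ).const_add p
  have h4 := HasMFDerivWithinAt.comp (s := univ) t h1
    h3.hasDerivWithinAt.hasFDerivWithinAt.hasMFDerivWithinAt (by simp)
  refine ⟨h4.mdifferentiableWithinAt, ?_⟩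
  have h5 := congrArg (fun L ↦ L (1 : ℝ)) (h4.mfderivWithin (uniqueMDiffWithinAt_univ _))
  refine h5.trans ?_
  rw [constField, h2]
  refine congrArg (mfderivWithin 𝓘(ℝ, EuclideanSpace ℝ (Fin n)) (𝓡 n) (extChartAt (𝓡 n) z).symm
    (range (𝓡 n)) (p + t • ξ)) ?_
  exact one_smul ℝ ξ

set_option synthInstance.maxHeartbeats 200000 in
/-- A linear combination of parallel metrics that vanishes at the start of a coordinate line
vanishes along it. -/
theorem sum_localForm_eq_zero_of_coordLine [T2Space M] {D : LinearConnection n M} {k : ℕ}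
    {g : Fin k → SemiRiemannianMetric n M} (hg : ∀ i, (g i).IsParallel D) {c : Fin k → ℝ} {z : M}
    {p ξ : EuclideanSpace ℝ (Fin n)}
    (ht : ∀ t ∈ Icc (0 : ℝ) 1, p + t • ξ ∈ (extChartAt (𝓡 n) z).target)
    (h0 : ∑ i, c i • (g i).localForm z ((extChartAt (𝓡 n) z).symm p) = 0) :
    ∑ i, c i • (g i).localForm z ((extChartAt (𝓡 n) z).symm (p + ξ)) = 0 := by
  let γ (t : ℝ) : M := (extChartAt (𝓡 n) z).symm (p + t • ξ)
  have hbase (t) (h : t ∈ Icc (0 : ℝ) 1) : γ t ∈ (tangentTriv n z).baseSet := by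
    rw [TangentBundle.trivializationAt_baseSet, ← extChartAt_source (𝓡 n)]
    exact (extChartAt (𝓡 n) z).map_target (ht t h)
  have hγ (t) (h : t ∈ Icc (0 : ℝ) 1) := mdifferentiableWithinAt_coordLine (ht t h)
  have hcont : ContinuousOn (fun t ↦ D.christoffel z ξ (γ t)) (Icc 0 1) :=
    (D.continuousOn_christoffel z ξ).comp
      (fun t h ↦ (hγ t h).1.continuousWithinAt.mono (subset_univ _)) hbase
  have := sum_smul_eq_zero_of_hasDerivWithinAt (F := EuclideanSpace ℝ (Fin n)) (c := c)
    (u := fun i t ↦ (g i).localForm z (γ t)) hcont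
    (fun i t h ↦ by
      have := (g i).hasDerivWithinAt_localForm_comp (hbase t h) (hγ t h).1
      rw [(hγ t h).2] at this
      exact this)
    (fun i t h a b ↦ (hg i).mvfderiv_localForm_constField (hbase t h) ξ a b)
    (by simpa [γ] using h0)
  simpa [γ] using this

theorem sum_localForm_eq_zero_iff {k : ℕ} {g : Fin k → SemiRiemannianMetric n M} {c : Fin k → ℝ}
    {z y : M} (hy : y ∈ (tangentTriv n z).baseSet) :
    ∑ i, c i • (g i).localForm z y = 0 ↔
      ∀ v w : TangentSpace (𝓡 n) y, ∑ i, c i * (g i).toFun y v w = 0 := by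
  constructor
  · intro h v w
    have := congrArg (fun L : EuclideanSpace ℝ (Fin n) →L[ℝ] EuclideanSpace ℝ (Fin n) →L[ℝ] ℝ ↦
      L (coeff z y v) (coeff z y w)) h
    simp only [sum_apply, smul_apply, smul_eq_mul, zero_apply] at this
    simpa only [(g _).apply_eq_localForm hy] using this
  · intro h
    ext a b : 2
    simp only [sum_apply, smul_apply, smul_eq_mul, zero_apply]
    exact h (constField z a y) (constField z b y)

set_option synthInstance.maxHeartbeats 200000 in
/-- On a connected manifold, a linear combination of parallel metrics that vanishes at one point
vanishes identically. -/
theorem sum_parallel_metrics_eq_zero [T2Space M] [ConnectedSpace M] {D : LinearConnection n M}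
    {k : ℕ} {g : Fin k → SemiRiemannianMetric n M} (hg : ∀ i, (g i).IsParallel D)
    {c : Fin k → ℝ} {x : M}
    (hx : ∀ v w : TangentSpace (𝓡 n) x, ∑ i, c i * (g i).toFun x v w = 0) (y : M)
    (v w : TangentSpace (𝓡 n) y) : ∑ i, c i * (g i).toFun y v w = 0 := by
  let Z : Set M := {y | ∀ v w : TangentSpace (𝓡 n) y, ∑ i, c i * (g i).toFun y v w = 0}
  -- Every point of a coordinate ball around `z` is joined to `z` by a straight segment inside the
  -- ball.
  have hopen : IsOpen Z := by
    rw [isOpen_iff_mem_nhds]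
    intro z hz
    obtain ⟨r, hr, hball⟩ := Metric.isOpen_iff.1 (isOpen_extChartAt_target (I := 𝓡 n) z)
      (extChartAt (𝓡 n) z z) (mem_extChartAt_target z)
    filter_upwards [(continuousAt_extChartAt (I := 𝓡 n) z).preimage_mem_nhds
      (Metric.ball_mem_nhds _ hr), extChartAt_source_mem_nhds (I := 𝓡 n) z] with y hy hys
    have hyb : y ∈ (tangentTriv n z).baseSet := by
      rwa [TangentBundle.trivializationAt_baseSet, ← extChartAt_source (𝓡 n)]
    refine (sum_localForm_eq_zero_iff hyb).1 ?_
    have h := sum_localForm_eq_zero_of_coordLine hg (c := c) (z := z) (p := extChartAt (𝓡 n) z z)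
      (ξ := extChartAt (𝓡 n) z y - extChartAt (𝓡 n) z z)
      (fun t ht ↦ hball ((convex_ball _ r).add_smul_sub_mem (Metric.mem_ball_self hr) hy ht))
      (by
        rw [extChartAt_to_inv]
        exact (sum_localForm_eq_zero_iff (FiberBundle.mem_baseSet_trivializationAt' z)).2 hz)
    rwa [add_sub_cancel, (extChartAt (𝓡 n) z).left_inv hys] at h
  -- Only continuity of the metrics is needed here.
  have hclosed : IsClosed Z := by
    rw [← isOpen_compl_iff, isOpen_iff_mem_nhds]
    intro z hz
    have hzb : z ∈ (tangentTriv n z).baseSet := FiberBundle.mem_baseSet_trivializationAt' z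
    have hz' : ∑ i, c i • (g i).localForm z z ≠ 0 := fun h ↦
      hz ((sum_localForm_eq_zero_iff hzb).1 h)
    have hcont : ContinuousAt (fun y ↦ ∑ i, c i • (g i).localForm z y) z :=
      continuousAt_sum_smul
        (F := EuclideanSpace ℝ (Fin n) →L[ℝ] EuclideanSpace ℝ (Fin n) →L[ℝ] ℝ)
        fun i ↦ ((g i).contMDiffAt_localForm hzb).continuousAt
    filter_upwards [hcont.eventually_ne hz', (tangentTriv n z).open_baseSet.mem_nhds hzb]
      with y hy hyb h
    exact hy ((sum_localForm_eq_zero_iff hyb).2 h)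
  have huniv : Z = univ := IsClopen.eq_univ ⟨hclosed, hopen⟩ ⟨x, hx⟩
  exact (huniv ▸ mem_univ y : y ∈ Z) v w

end Propagation

/-! ### From parallel metrics to the commutant of the holonomy group -/

section Holonomy

variable {n : ℕ} {M : Type*} [TopologicalSpace M]
  [ChartedSpace (EuclideanSpace ℝ (Fin n)) M]

instance finiteDimensional_tangentSpace (x : M) :
    FiniteDimensional ℝ (TangentSpace (𝓡 n) x) :=
  inferInstanceAs (FiniteDimensional ℝ (EuclideanSpace ℝ (Fin n)))

theorem finrank_tangentSpace (x : M) : Module.finrank ℝ (TangentSpace (𝓡 n) x) = n :=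
  finrank_euclideanSpace_fin

variable [IsManifold (𝓡 n) ∞ M]

/-- The metric at a point, as an algebraic bilinear form. -/
noncomputable def SemiRiemannianMetric.bilinForm (g : SemiRiemannianMetric n M) (x : M) :
    LinearMap.BilinForm ℝ (TangentSpace (𝓡 n) x) :=
  (g.toFun x).toLinearMap₁₂

theorem SemiRiemannianMetric.separatingLeft_bilinForm (g : SemiRiemannianMetric n M) (x : M) :
    (g.bilinForm x).SeparatingLeft :=
  g.nondegenerate x

theorem SemiRiemannianMetric.nondegenerate_bilinForm (g : SemiRiemannianMetric n M) (x : M) :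
    (g.bilinForm x).Nondegenerate :=
  ⟨g.nondegenerate x, fun w hw ↦ g.nondegenerate x w fun v ↦ (g.symm x w v).trans (hw v)⟩

theorem SemiRiemannianMetric.IsParallel.bilinForm_holonomy {g : SemiRiemannianMetric n M}
    {D : LinearConnection n M} (h : g.IsParallel D) {x : M} :
    ∀ ψ ∈ D.holonomyGroup x, ∀ v w, g.bilinForm x (ψ v) (ψ w) = g.bilinForm x v w :=
  fun _ hψ v w ↦ h.eq_of_isParallelTranslation hψ v w

variable [T2Space M] [ConnectedSpace M] {D : LinearConnection n M} {k : ℕ}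
  {g : Fin k → SemiRiemannianMetric n M}

/-- Propagation turns a relation at `x` into one on `M`, so the metrics stay independent on `T_x M`.
The reference metric `i` is arbitrary, so that in (i) it can be the one with `p ≠ q`. -/
theorem LinearConnection.AreIndependentParallelMetrics.le_finrank_selfAdjointCommutant
    (hg : D.AreIndependentParallelMetrics g) (x : M) (i : Fin k) :
    k ≤ Module.finrank ℝ (selfAdjointCommutant (D.holonomyGroup x) ((g i).bilinForm x)) :=
  _root_.le_finrank_selfAdjointCommutant (B := fun i ↦ (g i).bilinForm x)
    ((g i).nondegenerate_bilinForm x) ((g i).symm x) (hg.2 i).bilinForm_holonomy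
    (fun c hc ↦ hg.1 c fun y ↦ sum_parallel_metrics_eq_zero hg.2 hc y)
    (fun i ↦ (g i).symm x) (fun i ↦ (hg.2 i).bilinForm_holonomy)

/-- On a zero tangent space the sum of all the metrics vanishes, and by propagation it would vanish
on `M`. -/
theorem LinearConnection.AreIndependentParallelMetrics.nontrivial_tangentSpace
    (hg : D.AreIndependentParallelMetrics g) (x : M) (i : Fin k) :
    Nontrivial (TangentSpace (𝓡 n) x) := by
  by_contra h
  rw [not_nontrivial_iff_subsingleton] at h
  have hc := hg.1 (fun _ ↦ 1) (fun y ↦ sum_parallel_metrics_eq_zero hg.2 (x := x) (fun v w ↦ by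
    simp [Subsingleton.elim v 0]) y) i
  exact one_ne_zero hc

end Holonomy

/-! ### The four cases, each assuming irreducibility at a point -/

theorem theorem1 {n : ℕ} {M : Type*} [TopologicalSpace M] [T2Space M] [ConnectedSpace M]
    [ChartedSpace (EuclideanSpace ℝ (Fin n)) M] [IsManifold (𝓡 n) ∞ M]
    (D : LinearConnection n M) :
    (∀ g : Fin 2 → SemiRiemannianMetric n M, D.AreIndependentParallelMetrics g →
      (∃ i p q, p ≠ q ∧ (g i).HasSignature p q) → D.HasReducibleHolonomy) ∧
    (n = 2 → ∀ g : Fin 2 → SemiRiemannianMetric n M, D.AreIndependentParallelMetrics g →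
      D.HasReducibleHolonomy) ∧
    (¬ n ≡ 0 [MOD 4] → ∀ g : Fin 3 → SemiRiemannianMetric n M,
      D.AreIndependentParallelMetrics g → D.HasReducibleHolonomy) ∧
    (∀ g : Fin 4 → SemiRiemannianMetric n M, D.AreIndependentParallelMetrics g →
      D.HasReducibleHolonomy) := by
  refine ⟨fun g hg ⟨i, p, q, hpq, hsig⟩ x ↦ ?_, fun hn g hg x ↦ ?_, fun hn g hg x ↦ ?_,
    fun g hg x ↦ ?_⟩
  · by_contra hG
    have := hg.nontrivial_tangentSpace x i
    obtain ⟨J, hJ, hJJ⟩ := exists_complexStructure_mem_selfAdjointCommutant hG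
      (hg.le_finrank_selfAdjointCommutant x i)
    have h : sigPos ((g i).quadraticForm x) = sigNeg ((g i).quadraticForm x) :=
      sigPos_toQuadraticMap_eq_sigNeg (congrArg Subtype.val hJJ) hJ
    exact hpq ((hsig x).1.symm.trans (h.trans (hsig x).2))
  · by_contra hG
    have := hg.nontrivial_tangentSpace x 0
    obtain ⟨J, hJ, hJJ⟩ := exists_complexStructure_mem_selfAdjointCommutant hG
      (hg.le_finrank_selfAdjointCommutant x 0)
    exact hG (actsReducibly_of_finrank_eq_two ((finrank_tangentSpace x).trans hn)
      ((g 0).separatingLeft_bilinForm x) (hg.2 0).bilinForm_holonomy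
      (congrArg Subtype.val hJJ) J.2 hJ)
  · by_contra hG
    have := hg.nontrivial_tangentSpace x 0
    obtain ⟨J, -, K, -, hJJ, hKK, hKJ⟩ := exists_quaternionStructure_mem_selfAdjointCommutant hG
      (hg.le_finrank_selfAdjointCommutant x 0)
    have h := four_dvd_finrank_of_anticommuting (congrArg Subtype.val hJJ)
      (congrArg Subtype.val hKK) (congrArg Subtype.val hKJ)
    rw [finrank_tangentSpace] at h
    exact hn (Nat.modEq_zero_iff_dvd.2 h)
  · by_contra hG
    have := hg.nontrivial_tangentSpace x 0
    have h := (hg.le_finrank_selfAdjointCommutant x 0).trans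
      (finrank_selfAdjointCommutant_le_three hG ((g 0).separatingLeft_bilinForm x))
    omega
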